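/- Let $\mathbb{F}\in\{\mathbb{R},\mathbb{C}\}$ and let $\mathcal{A}$ be a unital associative $\mathbb{F}$-algebra with involution $*$ (linear if $\mathbb{F}=\mathbb{R}$, conjugate-linear if $\mathbb{F}=\mathbb{C}$). A finite-dimensional $*$-representation of $\mathcal{A}$ is a unital $\mathbb{F}$-algebra homomorphism $\pi:\mathcal{A}\to \mathrm{End}_{\mathbb{F}}(V_\pi)$, where $V_\pi$ is a finite-dimensional (possibly zero) inner product space over $\mathbb{F}$, with $\pi(a^*)=\pi(a)^*$ for all $a\in\mathcal{A}$; put $$\mathcal{I}_{\mathrm{soft}}(\pi)=\{a\in\mathcal{A} : \det\pi(a)=0\}$$ (the determinant on the zero space is $1$). A left ideal $I\subseteq\mathcal{A}$ is real if, whenever $a_1,\dots,a_n\in\mathcal{A}$ satisfy $\sum_{j} a_j^*a_j\in I+I^*$, then $a_j\in I$ for every $j$. For a left ideal $I$ put $$\widehat I=\{p\in\mathcal{A} : pq\in I \text{ for some } q\in\mathcal{A}\setminus I\}.$$ **Proposition 6.1.** For a subset $\mathcal{S}\subseteq\mathcal{A}$ the following are equivalent: 1. $\mathcal{S}=\mathcal{I}_{\mathrm{soft}}(\pi)$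 for some finite-dimensional $*$-representation $\pi$ of $\mathcal{A}$. 2. $\mathcal{S}=\bigcup_{i=1}^k\widehat{I_i}$ for some integer $k\ge 0$ and some real left ideals $I_1,\dots,I_k$ of $\mathcal{A}$ with $\dim_{\mathbb{F}}\mathcal{A}/I_i<\infty$ for each $i$. -/

import Mathlib

universe u v

/-- A finite-dimensional `*`-representation of the unital `*`-algebra `A` over `𝕜`: a unital
`𝕜`-algebra homomorphism `π` from `A` to the linear operators on a finite-dimensional pre-Hilbert
space `V` over `𝕜`, such that `π (star a)` is the adjoint of `π a`. The space may be zero. -/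
structure FinDimStarRep (𝕜 : Type) [RCLike 𝕜] (A : Type u) [Ring A] [StarRing A]
    [Algebra 𝕜 A] [StarModule 𝕜 A] where
  V : Type v
  [normed : NormedAddCommGroup V]
  [innerProd : InnerProductSpace 𝕜 V]
  [finDim : FiniteDimensional 𝕜 V]
  π : A →ₐ[𝕜] Module.End 𝕜 V
  adjoint : ∀ (a : A) (x y : V), inner 𝕜 (π a x) y = inner 𝕜 x (π (star a) y)

attribute [instance] FinDimStarRep.normed FinDimStarRep.innerProd FinDimStarRep.finDim

/-- The soft vanishing set of a set `T` of finite-dimensional `*`-representations. -/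
def softVanishingSet {𝕜 : Type} [RCLike 𝕜] {A : Type u} [Ring A] [StarRing A]
    [Algebra 𝕜 A] [StarModule 𝕜 A] (T : Set (FinDimStarRep.{u, v} 𝕜 A)) : Set A :=
  {a | ∀ ρ ∈ T, LinearMap.det (ρ.π a) = 0}

/-- A left ideal `I` is real if `∑ star (a j) * a j ∈ I + I^*` (a finite sum) forces every
`a j` to lie in `I`. (For a noncommutative ring, `Ideal A` is the type of left ideals.) -/
def IsRealLeftIdeal {A : Type u} [Ring A] [StarRing A] (I : Ideal A) : Prop :=
  ∀ (n : ℕ) (a : Fin n → A),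
    (∃ b ∈ I, ∃ c ∈ I, ∑ j, star (a j) * a j = b + star c) → ∀ j, a j ∈ I

/-- `I` has finite codimension in `A` as a `𝕜`-subspace. -/
def HasFiniteCodim (𝕜 : Type) [RCLike 𝕜] {A : Type u} [Ring A] [Algebra 𝕜 A]
    (I : Ideal A) : Prop :=
  FiniteDimensional 𝕜 (A ⧸ Submodule.restrictScalars 𝕜 I)

/-- The set `Î` of all `p` such that `p * q ∈ I` for some `q ∉ I`. -/
def leftIdealHat {A : Type u} [Ring A] (I : Ideal A) : Set A :=
  {p | ∃ q, q ∉ I ∧ p * q ∈ I}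

/-! From representations to ideals: a finite-dimensional `*`-representation is an orthogonal sum of
cyclic ones, so `π p` is singular iff it kills a nonzero `π q v` for one of finitely many cyclic
vectors `v`. If `I` is the annihilator of `v`, this says `q ∉ I` and `p * q ∈ I`.

From ideals to representations: GNS. A real left ideal `I` of finite codimension admits a Hermitian
functional `φ`, zero on `I`, with `φ (star a * a)` positive for `a ∉ I`. Then `φ (star a * b)` is an
inner product on `A ⧸ I`, left multiplication is a `*`-representation, and it is singular exactly on
`Î`; direct sums yield unions.

The crux is the existence of `φ`. Modulo `I + I^*`, sums of squares form a linear image of the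
positive semidefinite matrices. Realness says that the image of the compact convex set of those of
trace one misses zero, so Hahn–Banach separates it from zero. -/

open scoped Matrix

/-! ### Separation for positive semidefinite matrices. -/

section MatrixOrder
open scoped MatrixOrder

theorem exists_eq_conjTranspose_mul_self_of_posSemidef {m : ℕ} {M : Matrix (Fin m) (Fin m) ℝ}
    (hM : M.PosSemidef) : ∃ N : Matrix (Fin m) (Fin m) ℝ, M = Nᴴ * N :=
  CStarAlgebra.nonneg_iff_eq_star_mul_self.1 hM.nonneg

end MatrixOrder

/-- The positive semidefinite real matrices of trace one form a convex set. -/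
theorem convex_posSemidef_trace_one (m : ℕ) :
    Convex ℝ {M : Matrix (Fin m) (Fin m) ℝ | M.PosSemidef ∧ M.trace = 1} := by
  rintro M ⟨hM, hM1⟩ N ⟨hN, hN1⟩ s t hs ht hst
  refine ⟨(hM.smul hs).add (hN.smul ht), ?_⟩
  simp [Matrix.trace_add, Matrix.trace_smul, hM1, hN1, hst]

/-- The positive semidefinite real matrices of trace one form a compact set. -/
theorem isCompact_posSemidef_trace_one (m : ℕ) :
    IsCompact {M : Matrix (Fin m) (Fin m) ℝ | M.PosSemidef ∧ M.trace = 1} := by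
  -- The trace of `Nᵀ * N` is the squared Frobenius norm of `N`, so the set is the continuous image
  -- of a unit sphere.
  let F : EuclideanSpace ℝ (Fin m × Fin m) → Matrix (Fin m) (Fin m) ℝ :=
    fun x => (Matrix.of fun i j => x (i, j))ᵀ * (Matrix.of fun i j => x (i, j))
  have hF : Continuous F := by
    refine Continuous.matrix_mul (Continuous.matrix_transpose ?_) ?_ <;>
    · refine continuous_matrix fun i j => ?_
      simp only [Matrix.of_apply]
      fun_prop
  have htr : ∀ x, (F x).trace = ‖x‖ ^ 2 := by
    intro x
    rw [EuclideanSpace.real_norm_sq_eq, Fintype.sum_prod_type, Finset.sum_comm]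
    simp [F, Matrix.trace, Matrix.mul_apply, pow_two]
  have himage : {M : Matrix (Fin m) (Fin m) ℝ | M.PosSemidef ∧ M.trace = 1} =
      F '' Metric.sphere 0 1 := by
    ext M
    constructor
    · rintro ⟨hM, hM1⟩
      obtain ⟨N, rfl⟩ := exists_eq_conjTranspose_mul_self_of_posSemidef hM
      have hN : F (WithLp.toLp 2 fun p => N p.1 p.2) = Nᴴ * N := by
        simp only [F, Matrix.conjTranspose_eq_transpose_of_trivial]
        rfl
      refine ⟨WithLp.toLp 2 fun p => N p.1 p.2, ?_, hN⟩
      rw [← hN, htr] at hM1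
      simpa using (pow_eq_one_iff_of_nonneg (norm_nonneg _) two_ne_zero).1 hM1
    · rintro ⟨x, hx, rfl⟩
      refine ⟨?_, by simp_all⟩
      have := Matrix.posSemidef_conjTranspose_mul_self (Matrix.of fun i j => x (i, j))
      rwa [Matrix.conjTranspose_eq_transpose_of_trivial] at this
  rw [himage]
  exact (isCompact_sphere _ _).image hF

/-- A linear map that does not vanish at any positive semidefinite matrix of trace one can be
composed with a functional so as to be positive on these matrices. -/
theorem exists_dual_pos_of_ne_zero_on_posSemidef {m d : ℕ}
    (Φ : Matrix (Fin m) (Fin m) ℝ →ₗ[ℝ] (Fin d → ℝ))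
    (hΦ : ∀ M : Matrix (Fin m) (Fin m) ℝ, M.PosSemidef → M.trace = 1 → Φ M ≠ 0) :
    ∃ f : (Fin d → ℝ) →ₗ[ℝ] ℝ,
      ∀ M : Matrix (Fin m) (Fin m) ℝ, M.PosSemidef → M.trace = 1 → 0 < f (Φ M) := by
  have hc : IsCompact (Φ '' {M | M.PosSemidef ∧ M.trace = 1}) :=
    (isCompact_posSemidef_trace_one m).image Φ.continuous_of_finiteDimensional
  obtain ⟨f, r, h0, hf⟩ := geometric_hahn_banach_point_closed (x := 0)
    ((convex_posSemidef_trace_one m).linear_image Φ) hc.isClosed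
    (by rintro ⟨M, hM, h⟩; exact hΦ M hM.1 hM.2 h)
  refine ⟨f.toLinearMap, fun M h1 h2 => ?_⟩
  have := hf _ ⟨M, ⟨h1, h2⟩, rfl⟩
  rw [map_zero] at h0
  exact h0.trans this

/-! ### Positive functionals over the reals. -/

section Real

variable {A : Type u} [Ring A] [StarRing A] [Algebra ℝ A] [StarModule ℝ A]

/-- The real subspace `I + I^*`. -/
def addStarSubmodule (I : Ideal A) : Submodule ℝ A where
  carrier := {x | ∃ b ∈ I, ∃ c ∈ I, x = b + star c}
  zero_mem' := ⟨0, I.zero_mem, 0, I.zero_mem, by simp⟩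
  add_mem' := by
    rintro _ _ ⟨b, hb, c, hc, rfl⟩ ⟨b', hb', c', hc', rfl⟩
    exact ⟨b + b', I.add_mem hb hb', c + c', I.add_mem hc hc', by rw [star_add]; abel⟩
  smul_mem' := by
    rintro r _ ⟨b, hb, c, hc, rfl⟩
    exact ⟨r • b, (I.restrictScalars ℝ).smul_mem r hb, r • c,
      (I.restrictScalars ℝ).smul_mem r hc, by simp [star_smul]⟩

/-- Lets `a` be replaced by a representative modulo `I` when a functional killing `I + I^*` is
evaluated on its square. -/
theorem star_mul_self_add_sub_mem (I : Ideal A) (a b : A) (hb : b ∈ I) :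
    star (a + b) * (a + b) - star a * a ∈ addStarSubmodule I := by
  refine ⟨star (a + b) * b, I.mul_mem_left _ hb, star a * b, I.mul_mem_left _ hb, ?_⟩
  simp only [star_add, star_mul, star_star]
  noncomm_ring

theorem IsRealLeftIdeal.exists_pos_functional {I : Ideal A} (hI : IsRealLeftIdeal I)
    (hfin : HasFiniteCodim ℝ I) :
    ∃ f : A →ₗ[ℝ] ℝ, (∀ b ∈ I, f b = 0) ∧ (∀ a, f (star a) = f a) ∧
      ∀ a, a ∉ I → 0 < f (star a * a) := by
  have hIJ : I.restrictScalars ℝ ≤ addStarSubmodule I :=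
    fun b hb => ⟨b, hb, 0, I.zero_mem, by simp⟩
  have := hfin
  unfold HasFiniteCodim at this
  have hQ : FiniteDimensional ℝ (A ⧸ addStarSubmodule I) :=
    Module.Finite.of_surjective _ (Submodule.factor_surjective hIJ)
  -- `A` carries no topology; coordinates on the quotient by `I + I^*` provide one for the
  -- separation argument.
  let g : A →ₗ[ℝ] (Fin (Module.finrank ℝ (A ⧸ addStarSubmodule I)) → ℝ) :=
    (Module.finBasis ℝ (A ⧸ addStarSubmodule I)).equivFun.toLinearMap ∘ₗ
      (addStarSubmodule I).mkQ
  have hg : ∀ x, g x = 0 ↔ x ∈ addStarSubmodule I := by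
    intro x
    simp only [g, LinearMap.comp_apply, LinearEquiv.coe_coe, LinearEquiv.map_eq_zero_iff,
      Submodule.mkQ_apply, Submodule.Quotient.mk_eq_zero]
  let b := Module.finBasis ℝ (A ⧸ I.restrictScalars ℝ)
  choose a ha using fun i => Submodule.mkQ_surjective _ (b i)
  have hmk : ∀ t : Fin (Module.finrank ℝ (A ⧸ I.restrictScalars ℝ)) → ℝ,
      (I.restrictScalars ℝ).mkQ (∑ i, t i • a i) = b.equivFun.symm t := by
    intro t
    simp [map_sum, ha, Module.Basis.equivFun_symm_apply, -Submodule.mkQ_apply]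
  have hindep : ∀ t : Fin (Module.finrank ℝ (A ⧸ I.restrictScalars ℝ)) → ℝ,
      ∑ i, t i • a i ∈ I → t = 0 := by
    intro t ht
    have h1 : (I.restrictScalars ℝ).mkQ (∑ i, t i • a i) = 0 := by
      rw [Submodule.mkQ_apply, Submodule.Quotient.mk_eq_zero]
      exact ht
    rw [hmk] at h1
    exact b.equivFun.symm.map_eq_zero_iff.1 h1
  let Φ : Matrix (Fin (Module.finrank ℝ (A ⧸ I.restrictScalars ℝ)))
      (Fin (Module.finrank ℝ (A ⧸ I.restrictScalars ℝ))) ℝ →ₗ[ℝ] A :=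
    { toFun := fun M => ∑ i, ∑ j, M i j • (star (a i) * a j)
      map_add' := fun M N => by simp [add_smul, Finset.sum_add_distrib]
      map_smul' := fun r M => by simp [Finset.smul_sum, mul_smul] }
  have hsq : ∀ t : Fin (Module.finrank ℝ (A ⧸ I.restrictScalars ℝ)) → ℝ,
      star (∑ i, t i • a i) * (∑ i, t i • a i) = Φ (Matrix.vecMulVec t t) := by
    intro t
    simp [Φ, Matrix.vecMulVec_apply, star_sum, star_smul, Finset.sum_mul_sum, mul_smul,
      smul_comm (t _) (t _)]
  have hgram : ∀ N : Matrix (Fin (Module.finrank ℝ (A ⧸ I.restrictScalars ℝ)))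
      (Fin (Module.finrank ℝ (A ⧸ I.restrictScalars ℝ))) ℝ,
      Φ (Nᵀ * N) = ∑ k, star (∑ i, N k i • a i) * (∑ i, N k i • a i) := by
    intro N
    simp only [hsq, ← map_sum]
    congr 1
    ext i j
    simp [Matrix.mul_apply, Matrix.sum_apply, Matrix.vecMulVec_apply]
  -- If `Φ (Nᵀ * N)` lies in `I + I^*`, realness puts the combination given by each row of `N` into
  -- `I`. Independence modulo `I` then gives `N = 0`, against trace one.
  obtain ⟨f, hf⟩ := exists_dual_pos_of_ne_zero_on_posSemidef (g ∘ₗ Φ) (by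
    intro M hM htr h0
    obtain ⟨N, rfl⟩ := exists_eq_conjTranspose_mul_self_of_posSemidef hM
    rw [Matrix.conjTranspose_eq_transpose_of_trivial] at h0 htr
    rw [LinearMap.comp_apply, hg, hgram] at h0
    obtain ⟨c, hc, d, hd, hcd⟩ := h0
    have hN : N = 0 := by
      ext k i
      exact congrFun (hindep _ (hI _ _ ⟨c, hc, d, hd, hcd⟩ k)) i
    simp [hN] at htr)
  have hker : ∀ x ∈ addStarSubmodule I, f (g x) = 0 := fun x hx => by
    rw [(hg x).2 hx, map_zero]
  have hpos : ∀ x, x ∉ I → 0 < f (g (star x * x)) := by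
    intro x hx
    let t := b.equivFun ((I.restrictScalars ℝ).mkQ x)
    have hxt : x - ∑ i, t i • a i ∈ I := by
      have : (I.restrictScalars ℝ).mkQ (x - ∑ i, t i • a i) = 0 := by
        rw [map_sub, hmk, LinearEquiv.symm_apply_apply, sub_self]
      rwa [Submodule.mkQ_apply, Submodule.Quotient.mk_eq_zero] at this
    have ht : t ≠ 0 := by
      intro h0
      simp only [h0, Pi.zero_apply, zero_smul, Finset.sum_const_zero, sub_zero] at hxt
      exact hx hxt
    have hs : 0 < t ⬝ᵥ t :=
      lt_of_le_of_ne (Finset.sum_nonneg fun i _ => mul_self_nonneg _)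
        (fun h => ht (dotProduct_self_eq_zero.1 h.symm))
    have hpsd : (Matrix.vecMulVec t t).PosSemidef := by
      simpa using Matrix.posSemidef_vecMulVec_self_star t
    -- The square of `∑ i, t i • a i` comes from a rank-one matrix, here scaled to trace one.
    have h1 := hf ((t ⬝ᵥ t)⁻¹ • Matrix.vecMulVec t t) (hpsd.smul (inv_nonneg.2 hs.le)) (by
      rw [Matrix.trace_smul, Matrix.trace_vecMulVec, smul_eq_mul, inv_mul_cancel₀ hs.ne'])
    rw [map_smul, map_smul, smul_eq_mul, LinearMap.comp_apply, ← hsq] at h1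
    have h2 := hker _ (star_mul_self_add_sub_mem I (∑ i, t i • a i) _ hxt)
    rw [add_sub_cancel, map_sub, map_sub, sub_eq_zero] at h2
    rw [h2]
    exact pos_of_mul_pos_right h1 (inv_nonneg.2 hs.le)
  -- Adding the composite with `star` makes the functional `star`-invariant and doubles its values
  -- on squares.
  refine ⟨{ toFun := fun x => f (g x) + f (g (star x))
            map_add' := fun x y => by simp only [star_add, map_add]; ring
            map_smul' := fun r x => by
              simp only [star_smul, star_trivial, map_smul, smul_eq_mul, RingHom.id_apply]; ring },
    fun x hx => ?_, fun x => ?_, fun x hx => ?_⟩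
  · change f (g x) + f (g (star x)) = 0
    rw [hker _ (hIJ hx), hker _ ⟨0, I.zero_mem, x, hx, by simp⟩, add_zero]
  · change f (g _) + f (g (star _)) = f (g _) + f (g (star _))
    rw [star_star, add_comm]
  · change 0 < f (g _) + f (g (star _))
    rw [star_mul, star_star]
    exact add_pos (hpos x hx) (hpos x hx)

end Real

/-! ### Annihilators and cyclic decomposition. -/

theorem det_eq_zero_iff_exists_ne_zero {𝕜 : Type} [RCLike 𝕜] {V : Type*} [AddCommGroup V]
    [Module 𝕜 V] [FiniteDimensional 𝕜 V] (T : Module.End 𝕜 V) :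
    LinearMap.det T = 0 ↔ ∃ x, x ≠ 0 ∧ T x = 0 := by
  rw [← not_iff_not, ← ne_eq, ← isUnit_iff_ne_zero, ← LinearMap.isUnit_iff_isUnit_det,
    LinearMap.isUnit_iff_ker_eq_bot, LinearMap.ker_eq_bot']
  push Not
  exact forall_congr' fun x => ⟨fun h hx h0 => hx (h h0), fun h h0 => by_contra fun hx => h hx h0⟩

section

variable {𝕜 : Type} [RCLike 𝕜] {A : Type u} [Ring A] [StarRing A] [Algebra 𝕜 A] [StarModule 𝕜 A]

theorem mem_softVanishingSet_singleton (ρ : FinDimStarRep.{u, v} 𝕜 A) (a : A) :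
    a ∈ softVanishingSet {ρ} ↔ ∃ x, x ≠ 0 ∧ ρ.π a x = 0 := by
  simp [softVanishingSet, det_eq_zero_iff_exists_ne_zero]

namespace FinDimStarRep

variable (ρ : FinDimStarRep.{u, v} 𝕜 A)

/-- The left ideal of the elements annihilating a vector. -/
def annihilator (v : ρ.V) : Ideal A where
  carrier := {a | ρ.π a v = 0}
  zero_mem' := by simp
  add_mem' := fun {a b} ha hb => by
    simp only [Set.mem_ofPred_eq] at ha hb ⊢
    rw [map_add, LinearMap.add_apply, ha, hb, add_zero]
  smul_mem' := fun c a ha => by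
    simp only [Set.mem_ofPred_eq] at ha ⊢
    rw [smul_eq_mul, map_mul, Module.End.mul_apply, ha, map_zero]

theorem mem_annihilator {v : ρ.V} {a : A} : a ∈ ρ.annihilator v ↔ ρ.π a v = 0 := Iff.rfl

theorem inner_apply_right (a : A) (x y : ρ.V) :
    inner 𝕜 x (ρ.π a y) = inner 𝕜 (ρ.π (star a) x) y := by
  rw [ρ.adjoint, star_star]

/-- Pairing `∑ star (a j) * a j` with `v` gives `∑ ‖π (a j) v‖ ^ 2`, while `b + star c` pairs to
zero. -/
theorem isRealLeftIdeal_annihilator (v : ρ.V) : IsRealLeftIdeal (ρ.annihilator v) := by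
  rintro n a ⟨b, hb, c, hc, h⟩ j
  rw [mem_annihilator] at hb hc ⊢
  have h1 : inner 𝕜 v (ρ.π (∑ j, star (a j) * a j) v) = ∑ j, ((‖ρ.π (a j) v‖ ^ 2 : ℝ) : 𝕜) := by
    rw [map_sum, LinearMap.sum_apply, inner_sum]
    refine Finset.sum_congr rfl fun i _ => ?_
    rw [map_mul, Module.End.mul_apply, ← ρ.adjoint, inner_self_eq_norm_sq_to_K]
    push_cast
    rfl
  rw [h, map_add, LinearMap.add_apply, hb, zero_add, ← ρ.adjoint, hc, inner_zero_left,
    ← RCLike.ofReal_sum, eq_comm, RCLike.ofReal_eq_zero,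
    Finset.sum_eq_zero_iff_of_nonneg fun _ _ => by positivity] at h1
  simpa using h1 j (Finset.mem_univ j)

/-- The cyclic subspace generated by a vector. -/
def cyclic (v : ρ.V) : Submodule 𝕜 ρ.V :=
  LinearMap.range (ρ.π.toLinearMap.flip v)

theorem mem_cyclic {v x : ρ.V} : x ∈ ρ.cyclic v ↔ ∃ a, ρ.π a v = x := Iff.rfl

theorem hasFiniteCodim_annihilator (v : ρ.V) : HasFiniteCodim 𝕜 (ρ.annihilator v) := by
  have h : (ρ.annihilator v).restrictScalars 𝕜 = LinearMap.ker (ρ.π.toLinearMap.flip v) := by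
    ext a
    rfl
  unfold HasFiniteCodim
  rw [h]
  exact Module.Finite.equiv (ρ.π.toLinearMap.flip v).quotKerEquivRange.symm

theorem mem_leftIdealHat_annihilator (v : ρ.V) (p : A) :
    p ∈ leftIdealHat (ρ.annihilator v) ↔ ∃ x ∈ ρ.cyclic v, x ≠ 0 ∧ ρ.π p x = 0 := by
  simp only [leftIdealHat, Set.mem_ofPred_eq, mem_annihilator, mem_cyclic, map_mul,
    Module.End.mul_apply]
  constructor
  · rintro ⟨q, h1, h2⟩
    exact ⟨_, ⟨q, rfl⟩, h1, h2⟩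
  · rintro ⟨_, ⟨q, rfl⟩, h1, h2⟩
    exact ⟨q, h1, h2⟩

/-- An invariant subspace is an orthogonal sum of finitely many cyclic subspaces, so that
injectivity on it can be tested on the latter. -/
theorem exists_cyclic_family (n : ℕ) (W : Submodule 𝕜 ρ.V) (hn : Module.finrank 𝕜 W = n)
    (hW : ∀ a, ∀ x ∈ W, ρ.π a x ∈ W) :
    ∃ l : List ρ.V, ∀ p, (∃ x ∈ W, x ≠ 0 ∧ ρ.π p x = 0) ↔
      ∃ v ∈ l, ∃ x ∈ ρ.cyclic v, x ≠ 0 ∧ ρ.π p x = 0 := by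
  induction n using Nat.strong_induction_on generalizing W with
  | _ n ih =>
  by_cases hbot : W = ⊥
  · refine ⟨[], fun p => ?_⟩
    simp [hbot]
  obtain ⟨v, hv, hv0⟩ := Submodule.exists_mem_ne_zero_of_ne_bot hbot
  have hvC : v ∈ ρ.cyclic v := ⟨1, by simp⟩
  have hCW : ρ.cyclic v ≤ W := by
    rintro _ ⟨a, rfl⟩
    exact hW a v hv
  have hC : ∀ a, ∀ x ∈ ρ.cyclic v, ρ.π a x ∈ ρ.cyclic v := by
    rintro a _ ⟨b, rfl⟩
    exact ⟨a * b, by simp⟩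
  have hCo : ∀ a, ∀ x ∈ (ρ.cyclic v)ᗮ, ρ.π a x ∈ (ρ.cyclic v)ᗮ := by
    intro a x hx y hy
    rw [inner_apply_right]
    exact hx _ (hC _ _ hy)
  have hlt : W ⊓ (ρ.cyclic v)ᗮ < W := by
    refine lt_of_le_of_ne inf_le_left fun h => hv0 ?_
    have h1 : v ∈ W ⊓ (ρ.cyclic v)ᗮ := by rwa [h]
    exact inner_self_eq_zero.1 (h1.2 v hvC)
  obtain ⟨l, hl⟩ := ih _ (hn ▸ Submodule.finrank_lt_finrank_of_lt hlt) _ rfl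
    (fun a x hx => Submodule.mem_inf.2 ⟨hW a x hx.1, hCo a x hx.2⟩)
  refine ⟨v :: l, fun p => ?_⟩
  simp only [List.mem_cons, exists_eq_or_imp, ← hl]
  constructor
  · rintro ⟨x, hx, hx0, hpx⟩
    obtain ⟨y, hy, z, hz, rfl⟩ := (ρ.cyclic v).exists_add_mem_mem_orthogonal x
    rw [map_add] at hpx
    -- The cyclic subspace and its complement are both invariant, so `π p y = -π p z` is orthogonal
    -- to itself.
    have hy' : ρ.π p y = 0 := by
      refine (inner_self_eq_zero (𝕜 := 𝕜)).1 ?_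
      have h1 := hCo p z hz _ (hC p y hy)
      rwa [eq_neg_of_add_eq_zero_right hpx, inner_neg_right, neg_eq_zero] at h1
    rw [hy', zero_add] at hpx
    by_cases h : y = 0
    · subst h
      rw [zero_add] at hx hx0
      exact Or.inr ⟨z, ⟨hx, hz⟩, hx0, hpx⟩
    · exact Or.inl ⟨y, hy, h, hy'⟩
  · rintro (⟨x, hx, h⟩ | ⟨x, hx, h⟩)
    · exact ⟨x, hCW hx, h⟩
    · exact ⟨x, hx.1, h⟩

theorem softVanishingSet_eq_iUnion_leftIdealHat :
    ∃ (k : ℕ) (I : Fin k → Ideal A), (∀ i, IsRealLeftIdeal (I i) ∧ HasFiniteCodim 𝕜 (I i)) ∧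
      softVanishingSet {ρ} = ⋃ i, leftIdealHat (I i) := by
  obtain ⟨l, hl⟩ := ρ.exists_cyclic_family _ ⊤ rfl fun _ _ _ => trivial
  refine ⟨l.length, fun i => ρ.annihilator (l.get i),
    fun i => ⟨ρ.isRealLeftIdeal_annihilator _, ρ.hasFiniteCodim_annihilator _⟩, ?_⟩
  ext p
  have := hl p
  simp only [Submodule.mem_top, true_and] at this
  rw [mem_softVanishingSet_singleton, this, Set.mem_iUnion]
  simp only [mem_leftIdealHat_annihilator]
  constructor
  · rintro ⟨v, hv, h⟩
    obtain ⟨i, rfl⟩ := List.get_of_mem hv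
    exact ⟨i, h⟩
  · rintro ⟨i, h⟩
    exact ⟨_, List.get_mem l i, h⟩

/-! ### Direct sums and change of universe. -/

/-- The orthogonal direct sum of finitely many representations. -/
noncomputable def directSum {k : ℕ} (σ : Fin k → FinDimStarRep.{u, v} 𝕜 A) :
    FinDimStarRep.{u, v} 𝕜 A where
  V := PiLp 2 fun i => (σ i).V
  π := AlgHom.ofLinearMap
    { toFun := fun a =>
        { toFun := fun x => WithLp.toLp 2 fun i => (σ i).π a (x i)
          map_add' := fun x y => by ext i; simp
          map_smul' := fun r x => by ext i; simp }
      map_add' := fun a b => by ext x i; simp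
      map_smul' := fun r a => by ext x i; simp }
    (by ext x i; simp) (fun a b => by ext x i; simp)
  adjoint := fun a x y => by
    simp only [PiLp.inner_apply]
    exact Finset.sum_congr rfl fun i _ => (σ i).adjoint a _ _

theorem softVanishingSet_directSum {k : ℕ} (σ : Fin k → FinDimStarRep.{u, v} 𝕜 A) :
    softVanishingSet {directSum σ} = ⋃ i, softVanishingSet {σ i} := by
  ext a
  have hmem : a ∈ softVanishingSet {directSum σ} ↔ ∃ x : PiLp 2 fun i => (σ i).V,
      x ≠ 0 ∧ (WithLp.toLp 2 fun i => (σ i).π a (x i) : PiLp 2 fun i => (σ i).V) = 0 :=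
    mem_softVanishingSet_singleton _ _
  simp only [Set.mem_iUnion, hmem, mem_softVanishingSet_singleton]
  constructor
  · rintro ⟨x, hx, h⟩
    by_contra! hc
    exact hx (PiLp.ext fun i => by_contra fun hi => hc i _ hi (congrArg (fun y => y.ofLp i) h))
  · rintro ⟨i, x, hx, h⟩
    refine ⟨WithLp.toLp 2 (Pi.single i x), fun h0 => hx ?_, PiLp.ext fun j => ?_⟩
    · simpa using congrArg (fun y : PiLp 2 fun i => (σ i).V => y i) h0
    · by_cases hj : j = i
      · subst hj
        simpa using h
      · simp [Pi.single_eq_of_ne hj]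

/-- Transport of a representation along a linear isometry equivalence. -/
noncomputable def transport {W : Type*} [NormedAddCommGroup W] [InnerProductSpace 𝕜 W]
    (e : ρ.V ≃ₗᵢ[𝕜] W) : FinDimStarRep 𝕜 A where
  V := W
  finDim := Module.Finite.equiv e.toLinearEquiv
  π := (e.toLinearEquiv.conjAlgEquiv 𝕜).toAlgHom.comp ρ.π
  adjoint := fun a x y => by
    have h := ρ.adjoint a (e.symm x) (e.symm y)
    rw [← e.inner_map_map, ← e.inner_map_map (e.symm x), e.apply_symm_apply,
      e.apply_symm_apply] at h
    exact h

theorem softVanishingSet_transport {W : Type*} [NormedAddCommGroup W] [InnerProductSpace 𝕜 W]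
    (e : ρ.V ≃ₗᵢ[𝕜] W) : softVanishingSet {ρ.transport e} = softVanishingSet {ρ} := by
  ext a
  have hmem : a ∈ softVanishingSet {ρ.transport e} ↔
      ∃ x : W, x ≠ 0 ∧ e (ρ.π a (e.symm x)) = 0 :=
    mem_softVanishingSet_singleton _ _
  rw [hmem, mem_softVanishingSet_singleton]
  constructor
  · rintro ⟨x, hx, h⟩
    exact ⟨e.symm x, fun h0 => hx (e.symm.map_eq_zero_iff.1 h0), e.map_eq_zero_iff.1 h⟩
  · rintro ⟨x, hx, h⟩
    exact ⟨e x, fun h0 => hx (e.map_eq_zero_iff.1 h0), by rw [e.symm_apply_apply, h, map_zero]⟩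

/-- Every finite-dimensional representation can be realized in any universe. -/
theorem exists_softVanishingSet_eq {A : Type u} [Ring A] [StarRing A] [Algebra 𝕜 A]
    [StarModule 𝕜 A] (ρ : FinDimStarRep.{u, u} 𝕜 A) :
    ∃ σ : FinDimStarRep.{u, v} 𝕜 A, softVanishingSet {σ} = softVanishingSet {ρ} :=
  -- Indexing the orthonormal basis by a `ULift` places the coordinate space in universe `v`.
  ⟨ρ.transport ((stdOrthonormalBasis 𝕜 ρ.V).reindex Equiv.ulift.{v}.symm).repr,
    ρ.softVanishingSet_transport _⟩

end FinDimStarRep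
end

/-! ### The GNS construction. -/

/-- Since `I` is a left ideal, vanishing on `I` handles the right factor; Hermitian symmetry
transfers this to the left one. -/
theorem functional_star_mul_congr {𝕜 : Type} [RCLike 𝕜] {A : Type u} [Ring A]
    [StarRing A] [Algebra 𝕜 A] {I : Ideal A} {φ : A →ₗ[𝕜] 𝕜}
    (h0 : ∀ b ∈ I, φ b = 0) (hs : ∀ a, φ (star a) = star (φ a)) {a a' b b' : A} (ha : a - a' ∈ I) (hb : b - b' ∈ I) :
    φ (star a * b) = φ (star a' * b') := by
  have h1 : φ (star a * b) = φ (star a * b') := by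
    rw [← sub_eq_zero, ← map_sub, ← mul_sub]
    exact h0 _ (I.mul_mem_left _ hb)
  have h2 : φ (star b' * a) = φ (star b' * a') := by
    rw [← sub_eq_zero, ← map_sub, ← mul_sub]
    exact h0 _ (I.mul_mem_left _ ha)
  rw [h1, ← star_star b', ← star_mul, hs, h2, ← hs, star_mul]

theorem Ideal.Quotient.out_sub_mem_of_mk_eq {A : Type u} [Ring A] {I : Ideal A} {x : A ⧸ I}
    {a : A} (h : Submodule.Quotient.mk a = x) : x.out - a ∈ I := by
  rw [← Submodule.Quotient.eq, h]
  exact Quotient.out_eq x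

section

variable {𝕜 : Type} [RCLike 𝕜] {A : Type u} [Ring A] [StarRing A] [Algebra 𝕜 A] [StarModule 𝕜 A]

/-- A real left ideal of finite codimension is the left kernel of a positive functional. -/
theorem IsRealLeftIdeal.exists_hermitian_functional {I : Ideal A} (hI : IsRealLeftIdeal I)
    (hfin : HasFiniteCodim 𝕜 I) :
    ∃ φ : A →ₗ[𝕜] 𝕜, (∀ b ∈ I, φ b = 0) ∧ (∀ a, φ (star a) = star (φ a)) ∧
      ∀ a, a ∉ I → 0 < RCLike.re (φ (star a * a)) := by
  -- Realness does not mention scalars, so the real case applies after restriction to `ℝ`.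
  let : Algebra ℝ A := Algebra.compHom A (algebraMap ℝ 𝕜)
  have hsmul : ∀ (r : ℝ) (a : A), r • a = (r : 𝕜) • a := fun _ _ => rfl
  have : IsScalarTower ℝ 𝕜 A := IsScalarTower.of_algebraMap_smul fun r a => (hsmul r a).symm
  have : StarModule ℝ A := ⟨fun r a => by
    rw [hsmul, hsmul, star_smul, RCLike.star_def, RCLike.conj_ofReal, star_trivial r]⟩
  have hfinR : HasFiniteCodim ℝ I := by
    have h1 : FiniteDimensional 𝕜 (A ⧸ I.restrictScalars 𝕜) := hfin
    exact Module.Finite.trans (R := ℝ) 𝕜 (A ⧸ I.restrictScalars 𝕜)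
  obtain ⟨f, hf0, hfs, hfp⟩ := hI.exists_pos_functional hfinR
  -- The extension is `φ a = f a - i f (i a)`; it is Hermitian because `f` is `star`-invariant and
  -- `star` is conjugate-linear.
  refine ⟨Module.Dual.extendRCLike f, fun b hb => ?_, fun a => ?_, fun a ha => ?_⟩
  · rw [Module.Dual.extendRCLike_apply, hf0 b hb,
      hf0 _ ((I.restrictScalars 𝕜).smul_mem RCLike.I hb)]
    simp
  · have h : f ((RCLike.I : 𝕜) • star a) = - f ((RCLike.I : 𝕜) • a) := by
      rw [← hfs ((RCLike.I : 𝕜) • a), star_smul, ← map_neg, ← neg_smul]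
      simp
    rw [Module.Dual.extendRCLike_apply, Module.Dual.extendRCLike_apply, hfs, h]
    simp
  · rw [Module.Dual.re_extendRCLike_apply]
    exact hfp a ha

/-- The inner product on `A ⧸ I` induced by a positive functional with left kernel `I`. -/
noncomputable abbrev quotientInnerCore {I : Ideal A} {φ : A →ₗ[𝕜] 𝕜} (h0 : ∀ b ∈ I, φ b = 0)
    (hs : ∀ a, φ (star a) = star (φ a)) (hp : ∀ a, a ∉ I → 0 < RCLike.re (φ (star a * a))) :
    InnerProductSpace.Core 𝕜 (A ⧸ I) where
  inner x y := φ (star x.out * y.out)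
  conj_inner_symm x y := by
    rw [starRingEnd_apply, ← hs, star_mul, star_star]
  re_inner_nonneg x := by
    by_cases hx : x.out ∈ I
    · rw [h0 _ (I.mul_mem_left _ hx), map_zero]
    · exact (hp _ hx).le
  add_left x y z := by
    have h : (x + y).out - (x.out + y.out) ∈ I := Ideal.Quotient.out_sub_mem_of_mk_eq <| by
      rw [Submodule.Quotient.mk_add]
      exact congrArg₂ (· + ·) (Quotient.out_eq x) (Quotient.out_eq y)
    rw [functional_star_mul_congr h0 hs h (b' := z.out) (by simp), star_add, add_mul, map_add]
  smul_left x y r := by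
    have h : (r • x).out - r • x.out ∈ I := Ideal.Quotient.out_sub_mem_of_mk_eq <| by
      rw [Submodule.Quotient.mk_smul]
      exact congrArg (r • ·) (Quotient.out_eq x)
    rw [functional_star_mul_congr h0 hs h (b' := y.out) (by simp), star_smul, smul_mul_assoc,
      map_smul, smul_eq_mul, starRingEnd_apply]
  definite x hx := by
    by_contra hne
    refine (hp x.out fun h => hne ?_).ne' (by rw [hx, map_zero])
    rw [← (Submodule.Quotient.mk_eq_zero I).2 h]
    exact (Quotient.out_eq x).symm

theorem IsRealLeftIdeal.exists_softVanishingSet_eq_leftIdealHat {I : Ideal A}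
    (hI : IsRealLeftIdeal I) (hfin : HasFiniteCodim 𝕜 I) :
    ∃ ρ : FinDimStarRep.{u, u} 𝕜 A, softVanishingSet {ρ} = leftIdealHat I := by
  obtain ⟨φ, h0, hs, hp⟩ := hI.exists_hermitian_functional hfin
  let core : InnerProductSpace.Core 𝕜 (A ⧸ I) := quotientInnerCore h0 hs hp
  let normed : NormedAddCommGroup (A ⧸ I) := core.toNormedAddCommGroup
  let innerProd : InnerProductSpace 𝕜 (A ⧸ I) := InnerProductSpace.ofCore core.toCore
  have hfd : FiniteDimensional 𝕜 (A ⧸ I) := hfin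
  let ρ : FinDimStarRep.{u, u} 𝕜 A :=
    { V := A ⧸ I
      π := Algebra.lsmul 𝕜 𝕜 (A ⧸ I)
      adjoint := fun c x y => by
        change φ (star (c • x).out * y.out) = φ (star x.out * (star c • y).out)
        have h : ∀ (d : A) (z : A ⧸ I), (d • z).out - d * z.out ∈ I := fun d z =>
          Ideal.Quotient.out_sub_mem_of_mk_eq <| by
            rw [← smul_eq_mul, Submodule.Quotient.mk_smul]
            exact congrArg (d • ·) (Quotient.out_eq z)
        rw [functional_star_mul_congr h0 hs (h c x) (b' := y.out) (by simp),
          functional_star_mul_congr h0 hs (a := x.out) (a' := x.out) (by simp) (h (star c) y),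
          star_mul, mul_assoc] }
  refine ⟨ρ, ?_⟩
  ext p
  have hmem : p ∈ softVanishingSet {ρ} ↔ ∃ x : A ⧸ I, x ≠ 0 ∧ p • x = 0 :=
    mem_softVanishingSet_singleton _ _
  rw [hmem, (Submodule.mkQ_surjective I).exists]
  refine exists_congr fun q => and_congr (not_congr (Submodule.Quotient.mk_eq_zero I)) ?_
  rw [Submodule.mkQ_apply, ← Submodule.Quotient.mk_smul, smul_eq_mul]
  exact Submodule.Quotient.mk_eq_zero I

end

theorem proposition6p1 {𝕜 : Type} [RCLike 𝕜] {A : Type u} [Ring A] [StarRing A]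
    [Algebra 𝕜 A] [StarModule 𝕜 A] (S : Set A) :
    (∃ ρ : FinDimStarRep.{u, v} 𝕜 A, S = softVanishingSet {ρ}) ↔
      (∃ (k : ℕ) (I : Fin k → Ideal A),
        (∀ i, IsRealLeftIdeal (I i) ∧ HasFiniteCodim 𝕜 (I i)) ∧
          S = ⋃ i, leftIdealHat (I i)) := by
  constructor
  · rintro ⟨ρ, rfl⟩
    exact ρ.softVanishingSet_eq_iUnion_leftIdealHat
  · rintro ⟨k, I, hI, rfl⟩
    choose ρ hρ using fun i => (hI i).1.exists_softVanishingSet_eq_leftIdealHat (hI i).2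
    choose σ hσ using fun i => FinDimStarRep.exists_softVanishingSet_eq.{u, v} (ρ i)
    refine ⟨FinDimStarRep.directSum σ, ?_⟩
    simp only [FinDimStarRep.softVanishingSet_directSum, hσ, hρ]
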